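/- A probability algebra is a Boolean algebra with a complete metric $d$ such that, writing $\mu(x)=d(0,x)$, one has $d(x,y)=\mu(x\triangle y)$, $\mu(x)+\mu(y)=\mu(x\cap y)+\mu(x\cup y)$ and $\mu(1)=1$. Automorphisms and isomorphisms are isometric Boolean isomorphisms, and $d(\tau_0,\tau_1)=\sup_x d(\tau_0(x),\tau_1(x))$ for automorphisms $\tau_0,\tau_1$. Let $\mathrm{APr}_A$ be the theory of atomless probability algebras with an aperiodic automorphism $\tau$ (for every event $a\neq 0$ and every $m>0$ there is $b\subseteq a$ with $\tau^m(b)\neq b$), in the continuous language $\{0,1,\cdot^c,\cup,\cap,\tau\}$. Let $\mathcal A\otimes\mathcal A'$ denote the free (independent) amalgam of probability algebras, i.e. the measure algebra of the product of probability spaces representing $\mathcal A$ and $\mathcal A'$, and let $\mathcal L$ be the measure algebra of $[0,1]$ with the Lebesgue measure. For $n>0$, $(a,\tau)$ generate an $n$-partition if $a,\tau(a),\dots,\tau^{n-1}(a)$ are pairwise disjoint and their union has measure $1$. Let $(\mathcal A,\tau_{\mathcal A})\preceq(\mathcal B,\tau_{\mathcal B})$ be an elementary extension of models of $\mathrm{APr}_A$,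 and suppose that $(\mathcal B,\tau_{\mathcal B})$ is partitioned over $\mathcal A$: $\mathcal B$ is separable, and there is an isomorphism $e:\mathcal B\cong\mathcal A\otimes\mathcal L$ with $e(a)=a\otimes 1$ for all $a\in\mathcal A$, such that, identifying $\mathcal B$ with $\mathcal A\otimes\mathcal L$ through $e$, for every $m>0$ there is $c_m\in\mathcal L$ such that $(1\otimes c_m,\tau_{\mathcal B})$ generate an $m$-partition all of whose members belong to $1\otimes\mathcal L$. Let $n>0$, and let $\ell_n\in\mathcal L$ and $\rho_n\in\mathrm{Aut}(\mathcal L)$ be such that $(\ell_n,\rho_n)$ generate an $n$-partition and $(\rho_n)^n=\mathrm{id}$. Then there exists $\tau'_{\mathcal B}\in\mathrm{Aut}(\mathcal B)$ such that: (i) $d(\tau_{\mathcal B},\tau'_{\mathcal B})\le \frac1{2n}$; (ii) $(\mathcal B,\tau'_{\mathcal B})\cong(\mathcal A,\tau_{\mathcal A})\otimes(\mathcal L,\rho_n)$ over $\mathcal A$, that is, there is an isomorphism $f:\mathcal B\cong\mathcal A\otimes\mathcal L$ with $f(a)=a\otimes 1$ for all $a\in\mathcal A$ and $f\circ\tau'_{\mathcal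 B}=(\tau_{\mathcal A}\otimes\rho_n)\circ f$. -/

import Mathlib

open MeasureTheory
open scoped symmDiff ENNReal

noncomputable section

namespace PrAlg

universe u v w z

/-! ## Probability algebras -/

/-- A probability algebra: a Boolean algebra with a complete metric `d` such that, writing
`μ x = d (0, x)`, one has `d (x, y) = μ (x ∆ y)`, `μ x + μ y = μ (x ∩ y) + μ (x ∪ y)` and
`μ 1 = 1`. -/
class ProbabilityAlgebra (A : Type u) extends BooleanAlgebra A, MetricSpace A, CompleteSpace A where
  dist_eq_symmDiff : ∀ x y : A, dist x y = dist ⊥ (x ∆ y)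
  modular : ∀ x y : A, dist ⊥ x + dist ⊥ y = dist ⊥ (x ⊓ y) + dist ⊥ (x ⊔ y)
  dist_bot_top : dist (⊥ : A) ⊤ = 1

/-- The measure of an event. -/
def mu {A : Type u} [ProbabilityAlgebra A] (a : A) : ℝ := dist ⊥ a

/-- An (isometric) isomorphism of probability algebras: an isomorphism of Boolean algebras which
preserves the distance. -/
structure Iso (A : Type u) (B : Type v) [ProbabilityAlgebra A] [ProbabilityAlgebra B] where
  toOrderIso : A ≃o B
  dist_map : ∀ x y : A, dist (toOrderIso x) (toOrderIso y) = dist x y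

instance {A : Type u} {B : Type v} [ProbabilityAlgebra A] [ProbabilityAlgebra B] :
    CoeFun (Iso A B) (fun _ => A → B) := ⟨fun f => f.toOrderIso⟩

/-- Automorphisms of a probability algebra. -/
abbrev Aut (A : Type u) [ProbabilityAlgebra A] := Iso A A

/-- The uniform convergence metric on `Aut A`: the supremum over `x` of `d (τ₀ x, τ₁ x)`. -/
def autDist {A : Type u} [ProbabilityAlgebra A] (τ₀ τ₁ : Aut A) : ℝ :=
  ⨆ x : A, dist (τ₀ x) (τ₁ x)

/-- Every event can be split into two halves. -/
def IsAtomless (A : Type u) [ProbabilityAlgebra A] : Prop :=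
  ∀ a : A, ∃ c : A, mu (a ⊓ c) = mu a / 2

/-- `τ` is aperiodic: for every non-zero event `a` and every `n > 0` some sub-event of `a` is not
fixed by `τⁿ`. -/
def IsAperiodic {A : Type u} [ProbabilityAlgebra A] (τ : Aut A) : Prop :=
  ∀ a : A, a ≠ ⊥ → ∀ n : ℕ, 0 < n → ∃ b : A, b ≤ a ∧ τ^[n] b ≠ b

/-- `(A, τ)` is a model of `APr_A`: an atomless probability algebra with an aperiodic
automorphism. -/
def IsModelAPrA (A : Type u) [ProbabilityAlgebra A] (τ : Aut A) : Prop :=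
  IsAtomless A ∧ IsAperiodic τ

/-- `(a, τ)` generate an `(n, ε)`-partition: `a, τ a, …, τⁿ⁻¹ a` are disjoint and their union has
measure at least `1 - ε`. -/
def GeneratesPartition {A : Type u} [ProbabilityAlgebra A] (a : A) (τ : Aut A) (n : ℕ) (ε : ℝ) :
    Prop :=
  (∀ i < n, ∀ j < n, i ≠ j → Disjoint (τ^[i] a) (τ^[j] a)) ∧
    1 - ε ≤ mu ((Finset.range n).sup fun i => τ^[i] a)

/-- An `n`-partition is an `(n, 0)`-partition. -/
def GeneratesNPartition {A : Type u} [ProbabilityAlgebra A] (a : A) (τ : Aut A) (n : ℕ) : Prop :=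
  GeneratesPartition a τ n 0

/-! ## Continuous logic in the language `{0, 1, ᶜ, ∪, ∩, τ}` and elementary extensions -/

/-- Terms of the language of probability algebras with a unary function symbol `τ`, in variables
indexed by `ℕ`. -/
inductive PTerm : Type
  | var : ℕ → PTerm
  | zero : PTerm
  | one : PTerm
  | compl : PTerm → PTerm
  | union : PTerm → PTerm → PTerm
  | inter : PTerm → PTerm → PTerm
  | tau : PTerm → PTerm

/-- Continuous formulas: the atomic formulas are the distances between terms; they are combined by
continuous `[0,1]`-valued connectives and by the quantifiers `sup` and `inf`. -/
inductive PFormula : Type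
  | dist : PTerm → PTerm → PFormula
  | conn : (n : ℕ) → C(Fin n → ℝ, unitInterval) → (Fin n → PFormula) → PFormula
  | sup : ℕ → PFormula → PFormula
  | inf : ℕ → PFormula → PFormula

/-- The value of a term in `(A, τ)` under an assignment of the variables. -/
def PTerm.eval {A : Type u} [ProbabilityAlgebra A] (τ : Aut A) (x : ℕ → A) : PTerm → A
  | .var i => x i
  | .zero => ⊥
  | .one => ⊤
  | .compl t => (t.eval τ x)ᶜ
  | .union s t => s.eval τ x ⊔ t.eval τ x
  | .inter s t => s.eval τ x ⊓ t.eval τ x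
  | .tau t => τ (t.eval τ x)

/-- The value (in `[0,1]`) of a formula in `(A, τ)` under an assignment of the variables. -/
def PFormula.eval {A : Type u} [ProbabilityAlgebra A] (τ : Aut A) : PFormula → (ℕ → A) → ℝ
  | .dist s t, x => Dist.dist (s.eval τ x) (t.eval τ x)
  | .conn _ c φ, x => (c fun i => (φ i).eval τ x : ℝ)
  | .sup i φ, x => ⨆ a : A, φ.eval τ (Function.update x i a)
  | .inf i φ, x => ⨅ a : A, φ.eval τ (Function.update x i a)

/-- `ι` is an elementary embedding of `(A, τA)` in `(B, τB)`; when `A` is identified with its image,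
this says that `(B, τB)` is an elementary extension of `(A, τA)`. -/
def IsElementaryEmbedding {A : Type u} {B : Type v} [ProbabilityAlgebra A] [ProbabilityAlgebra B]
    (τA : Aut A) (τB : Aut B) (ι : A → B) : Prop :=
  ∀ (φ : PFormula) (x : ℕ → A), φ.eval τB (fun i => ι (x i)) = φ.eval τA x

/-! ## The measure algebra of a probability space -/

section MeasureAlgebra

variable {X : Type u} [MeasurableSpace X]

/-- The measure algebra of a probability space: measurable sets, with the distance
`μ (s ∆ t)`, where sets at distance zero are identified. -/
def MeasureAlgebra (μ : Measure X) [IsProbabilityMeasure μ] : Type u :=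
  SeparationQuotient (MeasuredSets μ)

variable (μ : Measure X) [IsProbabilityMeasure μ]

instance : MetricSpace (MeasureAlgebra μ) :=
  inferInstanceAs (MetricSpace (SeparationQuotient (MeasuredSets μ)))

/-- The event determined by a measurable set. -/
def event (s : Set X) (hs : MeasurableSet s) : MeasureAlgebra μ :=
  SeparationQuotient.mk (⟨s, hs⟩ : MeasuredSets μ)

variable {μ}

theorem exists_event (a : MeasureAlgebra μ) : ∃ s hs, a = event μ s hs := by
  obtain ⟨⟨s, hs⟩, rfl⟩ := SeparationQuotient.surjective_mk a
  exact ⟨s, hs, rfl⟩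

theorem dist_event {s t : Set X} (hs : MeasurableSet s) (ht : MeasurableSet t) :
    dist (event μ s hs) (event μ t ht) = μ.real (s ∆ t) := rfl

theorem event_eq_iff {s t : Set X} {hs : MeasurableSet s} {ht : MeasurableSet t} :
    event μ s hs = event μ t ht ↔ s =ᵐ[μ] t := by
  rw [← dist_eq_zero, dist_event, measureReal_eq_zero_iff, measure_symmDiff_eq_zero_iff]

theorem inseparable_iff (s t : MeasuredSets μ) : Inseparable s t ↔ s.1 =ᵐ[μ] t.1 := by
  rw [← SeparationQuotient.mk_eq_mk]
  exact event_eq_iff (hs := s.2) (ht := t.2)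

/-- The union of two events. -/
def MeasureAlgebra.union : MeasureAlgebra μ → MeasureAlgebra μ → MeasureAlgebra μ :=
  Quotient.map₂ (fun s t => ⟨s.1 ∪ t.1, s.2.union t.2⟩) fun _ _ h _ _ h' =>
    (inseparable_iff _ _).2 (((inseparable_iff _ _).1 h).union ((inseparable_iff _ _).1 h'))

/-- The intersection of two events. -/
def MeasureAlgebra.inter : MeasureAlgebra μ → MeasureAlgebra μ → MeasureAlgebra μ :=
  Quotient.map₂ (fun s t => ⟨s.1 ∩ t.1, s.2.inter t.2⟩) fun _ _ h _ _ h' =>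
    (inseparable_iff _ _).2 (((inseparable_iff _ _).1 h).inter ((inseparable_iff _ _).1 h'))

/-- The complement of an event. -/
def MeasureAlgebra.complement : MeasureAlgebra μ → MeasureAlgebra μ :=
  Quotient.map (fun s => ⟨s.1ᶜ, s.2.compl⟩) fun _ _ h =>
    (inseparable_iff _ _).2 ((inseparable_iff _ _).1 h).compl

theorem event_congr {s t : Set X} {hs : MeasurableSet s} {ht : MeasurableSet t} (h : s = t) :
    event μ s hs = event μ t ht := by
  subst h; rfl

/-- The order of the measure algebra is inclusion up to a null set. -/
instance : LE (MeasureAlgebra μ) := ⟨fun a b => a.union b = b⟩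

theorem event_le_iff {s t : Set X} {hs : MeasurableSet s} {ht : MeasurableSet t} :
    event μ s hs ≤ event μ t ht ↔ s ≤ᵐ[μ] t := by
  rw [← union_ae_eq_right_iff_ae_subset]
  exact event_eq_iff

theorem event_mono {s t : Set X} {hs : MeasurableSet s} {ht : MeasurableSet t} (h : s ⊆ t) :
    event μ s hs ≤ event μ t ht :=
  event_le_iff.2 (Filter.Eventually.of_forall h)

instance : PartialOrder (MeasureAlgebra μ) where
  le_refl a := by
    obtain ⟨s, hs, rfl⟩ := exists_event a
    exact event_mono subset_rfl
  le_trans a b c hab hbc := by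
    obtain ⟨s, hs, rfl⟩ := exists_event a
    obtain ⟨t, ht, rfl⟩ := exists_event b
    obtain ⟨r, hr, rfl⟩ := exists_event c
    exact event_le_iff.2 ((event_le_iff.1 hab).trans (event_le_iff.1 hbc))
  le_antisymm a b hab hba := by
    obtain ⟨s, hs, rfl⟩ := exists_event a
    obtain ⟨t, ht, rfl⟩ := exists_event b
    exact event_eq_iff.2 ((event_le_iff.1 hab).antisymm (event_le_iff.1 hba))

instance : DistribLattice (MeasureAlgebra μ) where
  sup := MeasureAlgebra.union
  inf := MeasureAlgebra.inter
  le_sup_left a b := by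
    obtain ⟨s, hs, rfl⟩ := exists_event a
    obtain ⟨t, ht, rfl⟩ := exists_event b
    exact event_mono Set.subset_union_left
  le_sup_right a b := by
    obtain ⟨s, hs, rfl⟩ := exists_event a
    obtain ⟨t, ht, rfl⟩ := exists_event b
    exact event_mono Set.subset_union_right
  sup_le a b c hac hbc := by
    obtain ⟨s, hs, rfl⟩ := exists_event a
    obtain ⟨t, ht, rfl⟩ := exists_event b
    obtain ⟨r, hr, rfl⟩ := exists_event c
    refine event_le_iff.2 ?_
    filter_upwards [event_le_iff.1 hac, event_le_iff.1 hbc] with x h₁ h₂ hx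
    exact hx.elim h₁ h₂
  inf_le_left a b := by
    obtain ⟨s, hs, rfl⟩ := exists_event a
    obtain ⟨t, ht, rfl⟩ := exists_event b
    exact event_mono Set.inter_subset_left
  inf_le_right a b := by
    obtain ⟨s, hs, rfl⟩ := exists_event a
    obtain ⟨t, ht, rfl⟩ := exists_event b
    exact event_mono Set.inter_subset_right
  le_inf a b c hab hac := by
    obtain ⟨s, hs, rfl⟩ := exists_event a
    obtain ⟨t, ht, rfl⟩ := exists_event b
    obtain ⟨r, hr, rfl⟩ := exists_event c
    refine event_le_iff.2 ?_
    filter_upwards [event_le_iff.1 hab, event_le_iff.1 hac] with x h₁ h₂ hx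
    exact ⟨h₁ hx, h₂ hx⟩
  le_sup_inf a b c := by
    obtain ⟨s, hs, rfl⟩ := exists_event a
    obtain ⟨t, ht, rfl⟩ := exists_event b
    obtain ⟨r, hr, rfl⟩ := exists_event c
    exact event_mono (Set.union_inter_distrib_left _ _ _).symm.subset

instance : BooleanAlgebra (MeasureAlgebra μ) where
  compl := MeasureAlgebra.complement
  top := event μ Set.univ MeasurableSet.univ
  bot := event μ ∅ MeasurableSet.empty
  inf_compl_le_bot := by
    intro a
    obtain ⟨s, hs, rfl⟩ := exists_event a
    exact event_mono (Set.inter_compl_self s).subset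
  top_le_sup_compl := by
    intro a
    obtain ⟨s, hs, rfl⟩ := exists_event a
    exact event_mono (Set.union_compl_self s).symm.subset
  le_top := by
    intro a
    obtain ⟨s, hs, rfl⟩ := exists_event a
    exact event_mono (Set.subset_univ s)
  bot_le := by
    intro a
    obtain ⟨s, hs, rfl⟩ := exists_event a
    exact event_mono (Set.empty_subset s)

theorem event_bot : (⊥ : MeasureAlgebra μ) = event μ ∅ MeasurableSet.empty := rfl

theorem event_top : (⊤ : MeasureAlgebra μ) = event μ Set.univ MeasurableSet.univ := rfl

theorem dist_bot_event {s : Set X} (hs : MeasurableSet s) :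
    dist ⊥ (event μ s hs) = μ.real s := by
  rw [event_bot, dist_event]
  congr 1
  exact bot_symmDiff s

theorem event_sup {s t : Set X} (hs : MeasurableSet s) (ht : MeasurableSet t) :
    event μ s hs ⊔ event μ t ht = event μ (s ∪ t) (hs.union ht) := rfl

theorem event_inf {s t : Set X} (hs : MeasurableSet s) (ht : MeasurableSet t) :
    event μ s hs ⊓ event μ t ht = event μ (s ∩ t) (hs.inter ht) := rfl

theorem event_compl {s : Set X} (hs : MeasurableSet s) :
    (event μ s hs)ᶜ = event μ sᶜ hs.compl := rfl

theorem event_symmDiff {s t : Set X} (hs : MeasurableSet s) (ht : MeasurableSet t) :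
    event μ s hs ∆ event μ t ht = event μ (s ∆ t) (hs.symmDiff ht) := rfl

instance : CompleteSpace (MeasuredSets μ) := by
  refine EMetric.complete_of_convergent_controlled_sequences (fun n => (2⁻¹ : ℝ≥0∞) ^ n)
    (fun n => ENNReal.pow_pos (by simp) n) fun s hs => ?_
  let T : ℕ → Set X := fun n => ⋃ k, ((s (n + k) : Set X) ∆ s (n + k + 1))
  have hT : ∀ n, μ (T n) ≤ 2⁻¹ ^ n * 2 := by
    intro n
    calc μ (T n) ≤ ∑' k, μ ((s (n + k) : Set X) ∆ s (n + k + 1)) := measure_iUnion_le _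
      _ ≤ ∑' k, (2⁻¹ : ℝ≥0∞) ^ (n + k) :=
          ENNReal.tsum_le_tsum fun k => (hs (n + k) (n + k) (n + k + 1) le_rfl (by omega)).le
      _ = 2⁻¹ ^ n * 2 := by
          simp_rw [pow_add]
          rw [ENNReal.tsum_mul_left, ENNReal.tsum_geometric, ENNReal.one_sub_inv_two, inv_inv]
  have key : ∀ n x, x ∉ T n → ∀ k, (x ∈ (s (n + k) : Set X) ↔ x ∈ (s n : Set X)) := by
    intro n x hx k
    induction k with
    | zero => rfl
    | succ k ih =>
      rw [← ih]
      have h : x ∉ (s (n + k) : Set X) ∆ s (n + k + 1) := fun h => hx (Set.mem_iUnion.2 ⟨k, h⟩)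
      rw [Set.mem_symmDiff] at h
      rw [← add_assoc]
      tauto
  let L : MeasuredSets μ := ⟨⋂ n, ⋃ k, (s (n + k) : Set X),
    .iInter fun n => .iUnion fun k => (s (n + k)).2⟩
  refine ⟨L, ?_⟩
  have hL : ∀ n, edist (s n) L ≤ 2⁻¹ ^ n * 2 := by
    intro n
    refine le_trans (measure_mono ?_) (hT n)
    intro x hx
    by_contra hxT
    have hk := key n x hxT
    have : x ∈ (L : Set X) ↔ x ∈ (s n : Set X) := by
      change x ∈ (⋂ n, ⋃ k, (s (n + k) : Set X)) ↔ _
      simp only [Set.mem_iInter, Set.mem_iUnion]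
      constructor
      · intro h
        obtain ⟨k, h⟩ := h n
        exact (hk k).1 h
      · intro h m
        refine ⟨n, ?_⟩
        rw [add_comm]
        exact (hk m).2 h
    rw [Set.mem_symmDiff] at hx
    tauto
  rw [tendsto_iff_edist_tendsto_0]
  refine tendsto_of_tendsto_of_tendsto_of_le_of_le tendsto_const_nhds ?_ (fun _ => zero_le) hL
  have h0 := ENNReal.Tendsto.mul_const (b := 2)
    (ENNReal.tendsto_pow_atTop_nhds_zero_of_lt_one (r := 2⁻¹) (by simp)) (Or.inr (by simp))
  simpa using h0

instance : CompleteSpace (MeasureAlgebra μ) :=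
  inferInstanceAs (CompleteSpace (SeparationQuotient (MeasuredSets μ)))

instance : ProbabilityAlgebra (MeasureAlgebra μ) where
  toBooleanAlgebra := inferInstance
  dist_eq_symmDiff := by
    intro a b
    obtain ⟨s, hs, rfl⟩ := exists_event a
    obtain ⟨t, ht, rfl⟩ := exists_event b
    rw [event_symmDiff, dist_event, dist_bot_event]
  modular := by
    intro a b
    obtain ⟨s, hs, rfl⟩ := exists_event a
    obtain ⟨t, ht, rfl⟩ := exists_event b
    rw [event_inf, event_sup]
    simp only [dist_bot_event]
    rw [add_comm (μ.real (s ∩ t)), measureReal_union_add_inter ht]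
  dist_bot_top := by
    rw [event_top, dist_bot_event, probReal_univ]

end MeasureAlgebra

/-! ## The Stone space of a probability algebra and its measure -/

section Stone

/-- The Stone space: points are the homomorphisms to the two element Boolean algebra. -/
def Stone (A : Type u) [ProbabilityAlgebra A] : Type u := BoundedLatticeHom A Bool

variable {A : Type u} [ProbabilityAlgebra A]

/-- The value of a point of the Stone space at an event. -/
def Stone.val (p : Stone A) : A → Bool := fun a => (show BoundedLatticeHom A Bool from p) a

/-- The clopen subset of the Stone space determined by an event. -/
def clopen (a : A) : Set (Stone A) := {p | p.val a = true}

/-- The `σ`-algebra generated by the clopen sets. -/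
instance : MeasurableSpace (Stone A) := MeasurableSpace.generateFrom (Set.range (clopen (A := A)))

theorem measurableSet_clopen (a : A) : MeasurableSet (clopen a) :=
  MeasurableSpace.measurableSet_generateFrom ⟨a, rfl⟩

theorem clopen_inf (a b : A) : clopen (a ⊓ b) = clopen a ∩ clopen b := by
  ext p
  have : p.val (a ⊓ b) = (p.val a && p.val b) := map_inf (show BoundedLatticeHom A Bool from p) a b
  simp [clopen, this]

theorem clopen_sup (a b : A) : clopen (a ⊔ b) = clopen a ∪ clopen b := by
  ext p
  have : p.val (a ⊔ b) = (p.val a || p.val b) := map_sup (show BoundedLatticeHom A Bool from p) a b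
  simp [clopen, this]

theorem clopen_bot : clopen (⊥ : A) = ∅ := by
  ext p
  have : p.val ⊥ = false := map_bot (show BoundedLatticeHom A Bool from p)
  simp [clopen, this]

theorem clopen_top : clopen (⊤ : A) = Set.univ := by
  ext p
  have : p.val ⊤ = true := map_top (show BoundedLatticeHom A Bool from p)
  simp [clopen, this]

theorem clopen_compl (a : A) : clopen aᶜ = (clopen a)ᶜ := by
  have h₁ := clopen_inf a aᶜ
  have h₂ := clopen_sup a aᶜ
  rw [inf_compl_eq_bot, clopen_bot] at h₁
  rw [sup_compl_eq_top, clopen_top] at h₂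
  exact (IsCompl.of_eq h₁.symm h₂.symm).compl_eq.symm

theorem clopen_sdiff (a b : A) : clopen (a \ b) = clopen a \ clopen b := by
  rw [sdiff_eq, clopen_inf, clopen_compl]; rfl

/-- For an ideal not containing `a` there is a point which is `1` at `a` and `0` on the ideal. -/
theorem exists_point (I : Order.Ideal A) (a : A) (ha : a ∉ I) :
    ∃ p : Stone A, p.val a = true ∧ ∀ b ∈ I, p.val b = false := by
  obtain ⟨J, hJ, hIJ, hd⟩ := DistribLattice.prime_ideal_of_disjoint_filter_ideal
    (F := Order.PFilter.principal a) (I := I) (by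
      rw [Set.disjoint_left]
      intro x hx hxI
      exact ha (I.lower (Order.PFilter.mem_principal.1 hx) hxI))
  classical
  have haJ : a ∉ J := Set.disjoint_left.1 hd (Order.PFilter.mem_principal.2 le_rfl)
  have htop : (⊤ : A) ∉ J := fun h => haJ (J.lower le_top h)
  have hinf : ∀ x y, x ⊓ y ∈ J ↔ x ∈ J ∨ y ∈ J := fun x y =>
    ⟨hJ.mem_or_mem, fun h => h.elim (J.lower inf_le_left) (J.lower inf_le_right)⟩
  have hsup : ∀ x y, x ⊔ y ∈ J ↔ x ∈ J ∧ y ∈ J := fun x y => Order.Ideal.sup_mem_iff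
  let q : BoundedLatticeHom A Bool :=
    { toFun := fun x => decide (x ∉ J)
      map_sup' := fun x y => by
        by_cases hx : x ∈ J <;> by_cases hy : y ∈ J <;> simp [hsup, hx, hy]
      map_inf' := fun x y => by
        by_cases hx : x ∈ J <;> by_cases hy : y ∈ J <;> simp [hinf, hx, hy]
      map_top' := by simp [htop]
      map_bot' := by simp }
  refine ⟨q, ?_, fun b hb => ?_⟩
  · change decide (a ∉ J) = true
    simp [haJ]
  · change decide (b ∉ J) = false
    simpa using hIJ hb

theorem exists_finset_of_clopen_subset {a : A} {f : ℕ → A} (h : clopen a ⊆ ⋃ i, clopen (f i)) :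
    ∃ n, a ≤ (Finset.range n).sup f := by
  by_contra! hn
  let I : Order.Ideal A :=
    { carrier := {x | ∃ n, x ≤ (Finset.range n).sup f}
      lower' := fun x y hyx ⟨n, hx⟩ => ⟨n, hyx.trans hx⟩
      nonempty' := ⟨⊥, 0, bot_le⟩
      directed' := by
        rintro x ⟨n, hx⟩ y ⟨m, hy⟩
        refine ⟨(Finset.range (max n m)).sup f, ⟨_, le_rfl⟩, hx.trans ?_, hy.trans ?_⟩
        · exact Finset.sup_mono (Finset.range_subset_range.2 (le_max_left _ _))
        · exact Finset.sup_mono (Finset.range_subset_range.2 (le_max_right _ _)) }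
  obtain ⟨p, hpa, hp⟩ := exists_point I a (fun ⟨n, h⟩ => hn n h)
  obtain ⟨i, hi⟩ := Set.mem_iUnion.1 (h hpa)
  have : p.val (f i) = false :=
    hp (f i) ⟨i + 1, Finset.le_sup (f := f) (Finset.mem_range.2 (Nat.lt_succ_self i))⟩
  have hi' : p.val (f i) = true := hi
  rw [this] at hi'
  exact absurd hi' (by simp)

theorem le_of_clopen_subset {a b : A} (h : clopen a ⊆ clopen b) : a ≤ b := by
  obtain ⟨n, hn⟩ := exists_finset_of_clopen_subset (f := fun _ => b)
    (h.trans (Set.subset_iUnion (fun _ : ℕ => clopen b) 0))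
  exact hn.trans (Finset.sup_le fun _ _ => le_rfl)

theorem clopen_mono {a b : A} (h : a ≤ b) : clopen a ⊆ clopen b := by
  rw [← inf_eq_left.2 h, clopen_inf]
  exact Set.inter_subset_right

theorem mu_bot : mu (⊥ : A) = 0 := dist_self _

theorem mu_nonneg (a : A) : 0 ≤ mu a := dist_nonneg

theorem mu_top : mu (⊤ : A) = 1 := ProbabilityAlgebra.dist_bot_top

theorem mu_inf_add_mu_sup (a b : A) : mu (a ⊓ b) + mu (a ⊔ b) = mu a + mu b :=
  (ProbabilityAlgebra.modular a b).symm

theorem mu_sup_of_disjoint {a b : A} (h : Disjoint a b) : mu (a ⊔ b) = mu a + mu b := by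
  rw [← mu_inf_add_mu_sup, h.eq_bot, mu_bot, zero_add]

theorem mu_mono {a b : A} (h : a ≤ b) : mu a ≤ mu b := by
  have := mu_sup_of_disjoint (a := a) (b := b \ a) disjoint_sdiff_self_right
  rw [sup_sdiff_cancel_right h] at this
  linarith [mu_nonneg (b \ a)]

theorem isSetRing_clopen : IsSetRing (Set.range (clopen (A := A))) where
  empty_mem := ⟨⊥, clopen_bot⟩
  union_mem := by
    rintro _ _ ⟨a, rfl⟩ ⟨b, rfl⟩
    exact ⟨a ⊔ b, clopen_sup a b⟩
  sdiff_mem := by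
    rintro _ _ ⟨a, rfl⟩ ⟨b, rfl⟩
    exact ⟨a \ b, clopen_sdiff a b⟩

/-- The set function `clopen a ↦ μ a`. -/
def clopenFun (s : Set (Stone A)) : ℝ≥0∞ := ⨆ (a : A) (_ : clopen a ⊆ s), ENNReal.ofReal (mu a)

theorem clopenFun_clopen (a : A) : clopenFun (clopen a) = ENNReal.ofReal (mu a) := by
  refine le_antisymm (iSup₂_le fun b hb => ?_) (le_iSup₂_of_le a subset_rfl le_rfl)
  exact ENNReal.ofReal_le_ofReal (mu_mono (le_of_clopen_subset hb))

/-- The content on the clopen sets given by the measure of the algebra. -/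
def clopenContent : AddContent ℝ≥0∞ (Set.range (clopen (A := A))) :=
  isSetRing_clopen.addContent_of_union clopenFun
    (by rw [← clopen_bot, clopenFun_clopen, mu_bot, ENNReal.ofReal_zero])
    (by
      rintro _ _ ⟨a, rfl⟩ ⟨b, rfl⟩ h
      have hab : Disjoint a b := by
        rw [disjoint_iff_inf_le]
        apply le_of_clopen_subset
        rw [clopen_inf, h.inter_eq]
        exact Set.empty_subset _
      rw [← clopen_sup, clopenFun_clopen, clopenFun_clopen, clopenFun_clopen,
        mu_sup_of_disjoint hab, ENNReal.ofReal_add (mu_nonneg a) (mu_nonneg b)])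

theorem clopenContent_clopen (a : A) : clopenContent (clopen a) = ENNReal.ofReal (mu a) :=
  clopenFun_clopen a

theorem isSigmaSubadditive_clopenContent : (clopenContent (A := A)).IsSigmaSubadditive := by
  intro f hf hU
  choose g hg using hf
  obtain ⟨a, ha⟩ := hU
  obtain rfl : (fun i => clopen (g i)) = f := funext hg
  obtain ⟨n, hn⟩ := exists_finset_of_clopen_subset ha.subset
  have hsub : (⋃ i, clopen (g i)) ⊆ ⋃ i ∈ Finset.range n, clopen (g i) := by
    rw [← ha]
    refine (clopen_mono hn).trans ?_
    clear hn
    induction n with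
    | zero => simp [clopen_bot]
    | succ n ih =>
      rw [Finset.range_add_one, Finset.sup_insert, clopen_sup, Finset.set_biUnion_insert]
      exact Set.union_subset_union_right _ ih
  calc clopenContent (⋃ i, clopen (g i))
      ≤ clopenContent (⋃ i ∈ Finset.range n, clopen (g i)) :=
        addContent_mono isSetRing_clopen.isSetSemiring ⟨a, ha⟩
          (isSetRing_clopen.biUnion_mem _ fun i _ => ⟨g i, rfl⟩) hsub
    _ ≤ ∑ i ∈ Finset.range n, clopenContent (clopen (g i)) :=
        addContent_biUnion_le isSetRing_clopen fun i _ => ⟨g i, rfl⟩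
    _ ≤ ∑' i, clopenContent (clopen (g i)) := ENNReal.sum_le_tsum _

variable (A) in
/-- The measure on the Stone space which extends `clopen a ↦ μ a`. -/
def stoneMeasure : Measure (Stone A) :=
  clopenContent.measure isSetRing_clopen.isSetSemiring le_rfl isSigmaSubadditive_clopenContent

theorem stoneMeasure_clopen (a : A) : stoneMeasure A (clopen a) = ENNReal.ofReal (mu a) := by
  rw [← clopenContent_clopen]
  exact clopenContent.measure_eq _ rfl _ ⟨a, rfl⟩

instance : IsProbabilityMeasure (stoneMeasure A) :=
  ⟨by rw [← clopen_top, stoneMeasure_clopen, mu_top, ENNReal.ofReal_one]⟩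

end Stone

/-! ## The free amalgam `A ⊗ B` -/

section Tensor

/-- The free amalgam `A ⊗ B` of two probability algebras: represent `A` and `B` as the measure
algebras of their Stone spaces and take the measure algebra of the product space. -/
abbrev Tensor (A : Type u) (B : Type v) [ProbabilityAlgebra A] [ProbabilityAlgebra B] :
    Type (max u v) :=
  MeasureAlgebra ((stoneMeasure A).prod (stoneMeasure B))

variable {A : Type u} {B : Type v} {C : Type w} {D : Type z}
  [ProbabilityAlgebra A] [ProbabilityAlgebra B] [ProbabilityAlgebra C] [ProbabilityAlgebra D]

/-- The embedding `a ↦ a ⊗ 1`. -/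
def inl (a : A) : Tensor A B :=
  event _ (clopen a ×ˢ Set.univ) ((measurableSet_clopen a).prod MeasurableSet.univ)

/-- The embedding `b ↦ 1 ⊗ b`. -/
def inr (b : B) : Tensor A B :=
  event _ (Set.univ ×ˢ clopen b) (MeasurableSet.univ.prod (measurableSet_clopen b))

theorem Iso.mu_map (f : Iso A B) (a : A) : mu (f a) = mu a := by
  have h := f.dist_map ⊥ a
  rwa [map_bot] at h

/-- The inverse isomorphism. -/
def Iso.symm (f : Iso A B) : Iso B A where
  toOrderIso := f.toOrderIso.symm
  dist_map x y := by
    rw [← f.dist_map, OrderIso.apply_symm_apply, OrderIso.apply_symm_apply]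

/-- The map between Stone spaces induced by an isomorphism, `p ↦ p ∘ f`. -/
def Stone.comap (f : Iso A B) (p : Stone B) : Stone A :=
  (show BoundedLatticeHom A Bool from
    { toFun := fun a => p.val (f a)
      map_sup' := fun x y => by
        rw [map_sup]
        exact map_sup (show BoundedLatticeHom B Bool from p) _ _
      map_inf' := fun x y => by
        rw [map_inf]
        exact map_inf (show BoundedLatticeHom B Bool from p) _ _
      map_top' := by
        rw [map_top]
        exact map_top (show BoundedLatticeHom B Bool from p)
      map_bot' := by
        rw [map_bot]
        exact map_bot (show BoundedLatticeHom B Bool from p) })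

theorem Stone.ext {p q : Stone A} (h : ∀ a, p.val a = q.val a) : p = q :=
  DFunLike.ext (F := BoundedLatticeHom A Bool) p q h

theorem Stone.comap_preimage (f : Iso A B) (a : A) :
    Stone.comap f ⁻¹' clopen a = clopen (f a) := rfl

theorem Stone.measurable_comap (f : Iso A B) : Measurable (Stone.comap f) := by
  apply measurable_generateFrom
  rintro _ ⟨a, rfl⟩
  exact measurableSet_clopen (f a)

/-- The isomorphism of Stone spaces induced by an isomorphism. -/
def Stone.equiv (f : Iso A B) : Stone B ≃ᵐ Stone A where
  toFun := Stone.comap f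
  invFun := Stone.comap f.symm
  left_inv p := Stone.ext fun b => congrArg p.val (f.toOrderIso.apply_symm_apply b)
  right_inv p := Stone.ext fun a => congrArg p.val (f.toOrderIso.symm_apply_apply a)
  measurable_toFun := Stone.measurable_comap f
  measurable_invFun := Stone.measurable_comap f.symm

theorem Stone.measurePreserving_equiv (f : Iso A B) :
    MeasurePreserving (Stone.equiv f) (stoneMeasure B) (stoneMeasure A) := by
  refine ⟨(Stone.equiv f).measurable, ?_⟩
  have : IsProbabilityMeasure ((stoneMeasure B).map (Stone.equiv f)) :=
    Measure.isProbabilityMeasure_map (Stone.equiv f).measurable.aemeasurable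
  refine ext_of_generate_finite (Set.range clopen) rfl isSetRing_clopen.isSetSemiring.isPiSystem
    ?_ (by rw [measure_univ, measure_univ])
  rintro _ ⟨a, rfl⟩
  rw [Measure.map_apply (Stone.equiv f).measurable (measurableSet_clopen a)]
  change stoneMeasure B (clopen (f a)) = _
  rw [stoneMeasure_clopen, stoneMeasure_clopen, Iso.mu_map]

/-- The pullback of events along a measure preserving map. -/
def pullback {X : Type u} {Y : Type v} [MeasurableSpace X] [MeasurableSpace Y] {μ : Measure X}
    {ν : Measure Y} [IsProbabilityMeasure μ] [IsProbabilityMeasure ν] {g : X → Y}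
    (hg : MeasurePreserving g μ ν) : MeasureAlgebra ν → MeasureAlgebra μ :=
  Quotient.map (fun s => ⟨g ⁻¹' s.1, hg.measurable s.2⟩) fun _ _ h =>
    (inseparable_iff _ _).2 (hg.quasiMeasurePreserving.preimage_ae_eq ((inseparable_iff _ _).1 h))

theorem pullback_event {X : Type u} {Y : Type v} [MeasurableSpace X] [MeasurableSpace Y]
    {μ : Measure X} {ν : Measure Y} [IsProbabilityMeasure μ] [IsProbabilityMeasure ν] {g : X → Y}
    (hg : MeasurePreserving g μ ν) {s : Set Y} (hs : MeasurableSet s) :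
    pullback hg (event ν s hs) = event μ (g ⁻¹' s) (hg.measurable hs) := rfl

theorem pullback_mono {X : Type u} {Y : Type v} [MeasurableSpace X] [MeasurableSpace Y]
    {μ : Measure X} {ν : Measure Y} [IsProbabilityMeasure μ] [IsProbabilityMeasure ν] {g : X → Y}
    (hg : MeasurePreserving g μ ν) : Monotone (pullback hg) := by
  intro a b h
  obtain ⟨s, hs, rfl⟩ := exists_event a
  obtain ⟨t, ht, rfl⟩ := exists_event b
  exact event_le_iff.2 (hg.quasiMeasurePreserving.preimage_mono_ae (event_le_iff.1 h))

/-- The isomorphism of measure algebras induced by an isomorphism of probability spaces. -/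
def isoOfMeasurableEquiv {X : Type u} {Y : Type v} [MeasurableSpace X] [MeasurableSpace Y]
    {μ : Measure X} {ν : Measure Y} [IsProbabilityMeasure μ] [IsProbabilityMeasure ν]
    (e : X ≃ᵐ Y) (he : MeasurePreserving e μ ν) : Iso (MeasureAlgebra ν) (MeasureAlgebra μ) where
  toOrderIso := Equiv.toOrderIso
    { toFun := pullback he
      invFun := pullback (he.symm e)
      left_inv := fun a => by
        obtain ⟨s, hs, rfl⟩ := exists_event a
        exact event_congr (e.symm_preimage_preimage s)
      right_inv := fun a => by
        obtain ⟨s, hs, rfl⟩ := exists_event a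
        exact event_congr (e.symm.symm_preimage_preimage s) }
    (pullback_mono he) (pullback_mono (he.symm e))
  dist_map a b := by
    obtain ⟨s, hs, rfl⟩ := exists_event a
    obtain ⟨t, ht, rfl⟩ := exists_event b
    exact he.measureReal_preimage (hs.symmDiff ht).nullMeasurableSet

/-- The isomorphism `f ⊗ g`, which sends `a ⊗ b` to `f a ⊗ g b`. -/
def Tensor.map (f : Iso A C) (g : Iso B D) : Iso (Tensor A B) (Tensor C D) :=
  isoOfMeasurableEquiv (MeasurableEquiv.prodCongr (Stone.equiv f) (Stone.equiv g))
    ((Stone.measurePreserving_equiv f).prod (Stone.measurePreserving_equiv g))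

theorem Tensor.map_inl (f : Iso A C) (g : Iso B D) (a : A) :
    Tensor.map f g (inl a) = inl (f a) := rfl

theorem Tensor.map_inr (f : Iso A C) (g : Iso B D) (b : B) :
    Tensor.map f g (inr b) = inr (g b) := rfl

end Tensor

/-! ## The Lebesgue algebra and partitioned extensions -/

/-- The Lebesgue algebra: the measure algebra of `[0,1]` with the Lebesgue measure. -/
abbrev Leb : Type := MeasureAlgebra (volume : Measure unitInterval)

/-- `(B, τB)` is partitioned over `A` (embedded in `B` by `ι`): `B` is separable, and there is an
isomorphism `e` of `B` with `A ⊗ L` over `A` such that for each `n > 0` there is `c ∈ L` for which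
`1 ⊗ c` generates, with `τB`, an `n`-partition all of whose members are in `1 ⊗ L`. -/
def IsPartitionedOver {A : Type u} {B : Type v} [ProbabilityAlgebra A] [ProbabilityAlgebra B]
    (ι : A → B) (τB : Aut B) : Prop :=
  TopologicalSpace.SeparableSpace B ∧
    ∃ e : Iso B (Tensor A Leb), (∀ a : A, e (ι a) = inl a) ∧
      ∀ n : ℕ, 0 < n → ∃ c : Leb, GeneratesNPartition (e.symm (inr c)) τB n ∧
        ∀ k < n, ∃ d : Leb, τB^[k] (e.symm (inr c)) = e.symm (inr d)

end PrAlg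

end

noncomputable section

namespace PrAlg

universe u₁ u₂ u₃

/-! ### Gluing isomorphisms along an event -/

section Iso

variable {A : Type u₁} {B : Type u₂} {C : Type u₃}
  [ProbabilityAlgebra A] [ProbabilityAlgebra B] [ProbabilityAlgebra C]

/-! Write `σ` for `τA ⊗ ρ`. It suffices to find an isomorphism `f : B ≅ A ⊗ L` over `A` with `f τB =
σ f` below an event `q` of measure at least `1 - 1/(2n)`. Then `τ' = f⁻¹ σ f` is conjugate to `σ`
over `A` by construction and agrees with `τB` below `q`, so its distance from `τB` is at most `1 -
μ(q)` (`autDist_le_of_eqOn`).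

To build `f`, take a tower `a, τA a, …` of height `4n` in `A` and climb it (`exists_intertwining`).
Start with the given isomorphism `e` and, level after level, replace the current map `f` on the next
level by `σ f τB⁻¹`, the only choice there that intertwines. Since `τB` and `σ` both extend `τA`,
the new map is again the prescribed one on `A`; since each level is an event of `A`, both maps send
it to the same event and can be glued along it (`Iso.glue`). Intertwining results on every level but
the top one.

The tower comes from elementarity. The hypothesis supplies an exact `4n`-partition only in `B`, but
the supremum of the measures of bases of towers of a given height is the value of a sentence, hence
the same in `A` (`IsElementaryEmbedding.exists_tower`). So `A` has towers that almost fill it.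
Losing the top level costs about `1/(4n)` and so does the part left uncovered, which gives `1/(2n)`.
-/

theorem Iso.symm_apply_apply' (f : Iso A B) (a : A) : f.symm (f a) = a :=
  f.toOrderIso.symm_apply_apply a

theorem Iso.apply_symm_apply' (f : Iso A B) (b : B) : f (f.symm b) = b :=
  f.toOrderIso.apply_symm_apply b

/-- The composition of isomorphisms. -/
def Iso.trans (f : Iso A B) (g : Iso B C) : Iso A C where
  toOrderIso := f.toOrderIso.trans g.toOrderIso
  dist_map x y := (g.dist_map _ _).trans (f.dist_map x y)

theorem Iso.trans_apply (f : Iso A B) (g : Iso B C) (a : A) : f.trans g a = g (f a) := rfl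

theorem Iso.map_inf' (f : Iso A B) (x y : A) : f (x ⊓ y) = f x ⊓ f y := map_inf f.toOrderIso x y

theorem Iso.map_sup' (f : Iso A B) (x y : A) : f (x ⊔ y) = f x ⊔ f y := map_sup f.toOrderIso x y

theorem Iso.map_compl' (f : Iso A B) (x : A) : f xᶜ = (f x)ᶜ := _root_.map_compl' f.toOrderIso x

theorem Iso.monotone' (f : Iso A B) {x y : A} (h : x ≤ y) : f x ≤ f y := f.toOrderIso.monotone h

theorem Iso.map_symmDiff' (f : Iso A B) (x y : A) : f (x ∆ y) = f x ∆ f y := by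
  simp only [symmDiff_eq, Iso.map_inf', Iso.map_sup', Iso.map_compl']

theorem Iso.map_disjoint (f : Iso A B) {x y : A} (h : Disjoint x y) : Disjoint (f x) (f y) :=
  h.map_orderIso f.toOrderIso

theorem mu_inf_add_mu_inf_compl (a p : A) : mu (a ⊓ p) + mu (a ⊓ pᶜ) = mu a := by
  rw [← mu_sup_of_disjoint ((disjoint_compl_right (a := p)).mono inf_le_right inf_le_right),
    ← inf_sup_left, sup_compl_eq_top, inf_top_eq]

theorem mu_compl (a : A) : mu aᶜ = 1 - mu a := by
  have := mu_inf_add_mu_inf_compl ⊤ a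
  rw [top_inf_eq, top_inf_eq, mu_top] at this
  linarith

theorem sup_inf_of_compl (x y q : A) : (x ⊓ q ⊔ y ⊓ qᶜ) ⊓ q = x ⊓ q := by
  rw [inf_sup_right, inf_assoc, inf_idem, inf_assoc, compl_inf_eq_bot, inf_bot_eq, sup_bot_eq]

theorem sup_inf_compl_of_compl (x y q : A) : (x ⊓ q ⊔ y ⊓ qᶜ) ⊓ qᶜ = y ⊓ qᶜ := by
  rw [inf_sup_right, inf_assoc, inf_compl_eq_bot, inf_bot_eq, bot_sup_eq, inf_assoc, inf_idem]

/-- The two pieces are inverted separately below `p` and `pᶜ`. The statement is symmetric in the two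
sides, so applied to `f.symm` and `g.symm` it also gives the other inverse law of the glued map. -/
theorem Iso.symm_glue (f g : Iso A B) {p : A} {q : B} (hf : f p = q) (hg : g p = q) (a : A) :
    f.symm (f a ⊓ q ⊔ g a ⊓ qᶜ) ⊓ p ⊔ g.symm (f a ⊓ q ⊔ g a ⊓ qᶜ) ⊓ pᶜ = a := by
  have h₁ : f.symm (f a ⊓ q ⊔ g a ⊓ qᶜ) ⊓ p = a ⊓ p := by
    conv_lhs => rw [← f.symm_apply_apply' p]
    rw [← Iso.map_inf', hf, sup_inf_of_compl, ← hf, ← Iso.map_inf', Iso.symm_apply_apply']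
  have h₂ : g.symm (f a ⊓ q ⊔ g a ⊓ qᶜ) ⊓ pᶜ = a ⊓ pᶜ := by
    conv_lhs => rw [← g.symm_apply_apply' pᶜ]
    rw [← Iso.map_inf', Iso.map_compl', hg, sup_inf_compl_of_compl, ← hg, ← Iso.map_compl',
      ← Iso.map_inf', Iso.symm_apply_apply']
  rw [h₁, h₂, ← inf_sup_left, sup_compl_eq_top, inf_top_eq]

/-- The isomorphism which is `f` below `p` and `g` below `pᶜ`. -/
def Iso.glue (f g : Iso A B) {p : A} {q : B} (hf : f p = q) (hg : g p = q) : Iso A B where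
  toOrderIso := Equiv.toOrderIso
    { toFun := fun a => f a ⊓ q ⊔ g a ⊓ qᶜ
      invFun := fun b => f.symm b ⊓ p ⊔ g.symm b ⊓ pᶜ
      left_inv := Iso.symm_glue f g hf hg
      right_inv := Iso.symm_glue f.symm g.symm (p := q) (q := p)
        (by rw [← hf, Iso.symm_apply_apply']) (by rw [← hg, Iso.symm_apply_apply']) }
    (fun _ _ h => sup_le_sup (inf_le_inf_right _ (f.monotone' h))
      (inf_le_inf_right _ (g.monotone' h)))
    (fun _ _ h => sup_le_sup (inf_le_inf_right _ (f.symm.monotone' h))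
      (inf_le_inf_right _ (g.symm.monotone' h)))
  dist_map x y := by
    change dist (f x ⊓ q ⊔ g x ⊓ qᶜ) (f y ⊓ q ⊔ g y ⊓ qᶜ) = _
    rw [ProbabilityAlgebra.dist_eq_symmDiff, ProbabilityAlgebra.dist_eq_symmDiff x]
    change mu _ = mu _
    -- Split the measure of the symmetric difference along `q` and `qᶜ`: each part is the image of
    -- the corresponding part of `x ∆ y`, under `f` or `g` alone.
    rw [← mu_inf_add_mu_inf_compl _ q, inf_symmDiff_distrib_right, inf_symmDiff_distrib_right,
      sup_inf_of_compl, sup_inf_of_compl, sup_inf_compl_of_compl, sup_inf_compl_of_compl,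
      ← inf_symmDiff_distrib_right, ← inf_symmDiff_distrib_right, ← Iso.map_symmDiff',
      ← Iso.map_symmDiff', ← mu_inf_add_mu_inf_compl (x ∆ y) p]
    congr 1
    · rw [← hf, ← Iso.map_inf', Iso.mu_map]
    · rw [← hg, ← Iso.map_compl', ← Iso.map_inf', Iso.mu_map]

theorem Iso.glue_apply (f g : Iso A B) {p : A} {q : B} (hf : f p = q) (hg : g p = q) (a : A) :
    f.glue g hf hg a = f a ⊓ q ⊔ g a ⊓ qᶜ := rfl

theorem Iso.glue_of_le (f g : Iso A B) {p : A} {q : B} (hf : f p = q) (hg : g p = q) {a : A}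
    (h : a ≤ p) : f.glue g hf hg a = f a := by
  have h₁ : f a ≤ q := hf ▸ f.monotone' h
  have h₂ : g a ≤ q := hg ▸ g.monotone' h
  rw [Iso.glue_apply, inf_eq_left.2 h₁, (disjoint_compl_right.mono_left h₂).eq_bot, sup_bot_eq]

theorem Iso.glue_of_disjoint (f g : Iso A B) {p : A} {q : B} (hf : f p = q) (hg : g p = q) {a : A}
    (h : Disjoint a p) : f.glue g hf hg a = g a := by
  have h₁ : Disjoint (f a) q := hf ▸ f.map_disjoint h
  have h₂ : Disjoint (g a) q := hg ▸ g.map_disjoint h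
  rw [Iso.glue_apply, h₁.eq_bot, bot_sup_eq, inf_eq_left.2 h₂.le_compl_right]

end Iso

/-! ### Towers and intertwining along them -/

section Tower

variable {A : Type u₁} {B : Type u₂} {C : Type u₃}
  [ProbabilityAlgebra A] [ProbabilityAlgebra B] [ProbabilityAlgebra C]

theorem mu_iterate (τ : Aut A) (k : ℕ) (a : A) : mu (τ^[k] a) = mu a := by
  induction k with
  | zero => rfl
  | succ k ih => rw [Function.iterate_succ_apply', Iso.mu_map, ih]

theorem disjoint_iterate (τ : Aut A) {a b : A} (h : Disjoint a b) (k : ℕ) :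
    Disjoint (τ^[k] a) (τ^[k] b) := by
  induction k with
  | zero => exact h
  | succ k ih =>
    rw [Function.iterate_succ_apply', Function.iterate_succ_apply']
    exact τ.map_disjoint ih

theorem mu_sup_iterate (τ : Aut A) {a : A} {N : ℕ}
    (h : ∀ i < N, ∀ j < N, i ≠ j → Disjoint (τ^[i] a) (τ^[j] a)) (k : ℕ) (hk : k ≤ N) :
    mu ((Finset.range k).sup fun i => τ^[i] a) = k * mu a := by
  induction k with
  | zero => simp [mu_bot]
  | succ k ih =>
    have hd : Disjoint (τ^[k] a) ((Finset.range k).sup fun i => τ^[i] a) :=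
      Finset.disjoint_sup_right.2 fun i hi =>
        have hik := Finset.mem_range.1 hi
        h k (by omega) i (by omega) (by omega)
    rw [Finset.range_add_one, Finset.sup_insert, mu_sup_of_disjoint hd, mu_iterate, ih (by omega)]
    push_cast
    ring

/-- The part of `a` which does not meet `τ a, …, τᵏ a`. -/
def wander (τ : Aut A) (k : ℕ) (a : A) : A :=
  a ⊓ ((Finset.range k).sup fun i => τ^[i + 1] a)ᶜ

/-- Applying a power of `τ` reduces to disjointness of the base from its image under `τ^[d + 1]`.
That image is below `τ^[d + 1] a`, which was removed from the base. Thus every event, not only a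
suitable one, yields an exact tower of height `k + 1`. -/
theorem disjoint_wander (τ : Aut A) (k : ℕ) (a : A) (i j : ℕ) (hi : i < k + 1) (hj : j < k + 1)
    (hij : i ≠ j) : Disjoint (τ^[i] (wander τ k a)) (τ^[j] (wander τ k a)) := by
  wlog h : i < j generalizing i j
  · exact (this j i hj hi hij.symm (by omega)).symm
  obtain ⟨d, rfl⟩ : ∃ d, j = i + (d + 1) := ⟨j - i - 1, by omega⟩
  rw [Function.iterate_add_apply]
  apply disjoint_iterate
  have hmono : τ^[d + 1] (wander τ k a) ≤ τ^[d + 1] a :=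
    (Monotone.iterate τ.toOrderIso.monotone (d + 1)) inf_le_left
  have hle : τ^[d + 1] a ≤ (Finset.range k).sup fun i => τ^[i + 1] a :=
    Finset.le_sup (f := fun i => τ^[i + 1] a) (Finset.mem_range.2 (by omega))
  exact (disjoint_compl_left (a := (Finset.range k).sup fun i => τ^[i + 1] a)).mono
    inf_le_right (hmono.trans hle)

theorem wander_eq_self (τ : Aut A) {k : ℕ} {a : A}
    (h : ∀ i < k + 1, ∀ j < k + 1, i ≠ j → Disjoint (τ^[i] a) (τ^[j] a)) : wander τ k a = a := by
  refine inf_eq_left.2 (Disjoint.le_compl_right (Finset.disjoint_sup_right.2 fun i hi => ?_))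
  have hik := Finset.mem_range.1 hi
  exact h 0 (by omega) (i + 1) (by omega) (by omega)

/-- An isomorphism over `A` can be modified along a tower in `A` so as to
intertwine `τ` and `σ` on the levels of the tower. -/
theorem exists_intertwining (τA : Aut A) (τ : Aut B) (σ : Aut C) (ι : A → B) (κ : A → C)
    (hι : ∀ x, τ (ι x) = ι (τA x)) (hκ : ∀ x, σ (κ x) = κ (τA x))
    (e : Iso B C) (he : ∀ x, e (ι x) = κ x) (a : A) (N : ℕ)
    (h : ∀ i < N, ∀ j < N, i ≠ j → Disjoint (τ^[i] (ι a)) (τ^[j] (ι a))) (k : ℕ) (hk : k < N) :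
    ∃ f : Iso B C, (∀ x, f (ι x) = κ x) ∧
      ∀ j < k, ∀ b ≤ τ^[j] (ι a), f (τ b) = σ (f b) := by
  have hit : ∀ j, τ^[j] (ι a) = ι (τA^[j] a) := by
    intro j
    induction j with
    | zero => rfl
    | succ j ih => rw [Function.iterate_succ_apply', Function.iterate_succ_apply', ih, hι]
  induction k with
  | zero => exact ⟨e, he, fun j hj => absurd hj (by omega)⟩
  | succ k ih =>
    obtain ⟨f, hf, hfj⟩ := ih (by omega)
    -- The candidate for the next level is `σ f τ⁻¹`. It remains a map over `A` because `τ` and `σ`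
    -- both act on `A` as `τA`.
    have hg : ∀ x, (τ.symm.trans (f.trans σ)) (ι x) = κ x := by
      intro x
      have hx : τ.symm (ι x) = ι (τA.symm x) := by
        rw [← τ.symm_apply_apply' (ι (τA.symm x)), hι, Iso.apply_symm_apply']
      rw [Iso.trans_apply, Iso.trans_apply, hx, hf, hκ, Iso.apply_symm_apply']
    have hlevel : ∀ j, j < k + 1 → ∀ b ≤ τ^[j] (ι a), Disjoint b (ι (τA^[k + 1] a)) := by
      intro j hj b hb
      rw [← hit]
      exact (h j (by omega) (k + 1) hk (by omega)).mono_left hb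
    refine ⟨Iso.glue _ f (hg (τA^[k + 1] a)) (hf (τA^[k + 1] a)), fun x => ?_, fun j hj b hb => ?_⟩
    · rw [Iso.glue_apply, hg, hf, ← inf_sup_left, sup_compl_eq_top, inf_top_eq]
    · have hτb : τ b ≤ τ^[j + 1] (ι a) := by
        rw [Function.iterate_succ_apply']
        exact τ.monotone' hb
      rw [Iso.glue_of_disjoint _ _ _ _ (hlevel j hj b hb)]
      -- If `j < k`, then `b` and `τ b` both avoid level `k + 1`, where alone `f` was changed. If `j
      -- = k`, then `τ b` lies in that level, where the new map sends it to `σ (f (τ⁻¹ (τ b)))`.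
      rcases Nat.lt_succ_iff_lt_or_eq.1 hj with hjk | rfl
      · rw [Iso.glue_of_disjoint _ _ _ _ (hlevel (j + 1) (by omega) _ hτb), hfj j hjk b hb]
      · rw [Iso.glue_of_le _ _ _ _ (hit (j + 1) ▸ hτb), Iso.trans_apply, Iso.trans_apply,
          Iso.symm_apply_apply']

/-- As `τ` and `σ` agree at `q` and at `x ⊓ q`, the event `τ x ∆ σ x` is disjoint from `τ q`, whose
complement has measure `1 - mu q`. -/
theorem autDist_le_of_eqOn (τ σ : Aut A) (q : A) (h : ∀ b ≤ q, τ b = σ b) :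
    autDist τ σ ≤ 1 - mu q := by
  refine ciSup_le fun x => ?_
  rw [ProbabilityAlgebra.dist_eq_symmDiff]
  change mu _ ≤ _
  rw [← mu_compl, ← τ.mu_map qᶜ, Iso.map_compl']
  refine mu_mono (Disjoint.le_compl_right (disjoint_iff.2 ?_))
  rw [inf_symmDiff_distrib_right, ← Iso.map_inf']
  conv_lhs => rw [h q le_rfl, ← Iso.map_inf', h _ inf_le_right]
  rw [symmDiff_self]

theorem eqOn_sup (τ σ : Aut A) {s : Finset ℕ} {p : ℕ → A}
    (h : ∀ j ∈ s, ∀ b ≤ p j, τ b = σ b) : ∀ b ≤ s.sup p, τ b = σ b := by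
  intro b hb
  -- Decompose `b` as the join of its parts `b ⊓ p j`.
  rw [← inf_eq_left.2 hb, Finset.sup_inf_distrib_left]
  rw [map_finset_sup, map_finset_sup]
  exact Finset.sup_congr rfl fun j hj => h j hj _ inf_le_right

end Tower

/-! ### Transfer of towers by elementarity -/

section Elementary

variable {A : Type u₁} {B : Type u₂} [ProbabilityAlgebra A] [ProbabilityAlgebra B]

/-- The term `τᵏ x₀`. -/
def PTerm.iter : ℕ → PTerm
  | 0 => .var 0
  | k + 1 => .tau (PTerm.iter k)

/-- The term `τ x₀ ∪ … ∪ τᵏ x₀`. -/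
def PTerm.orbit : ℕ → PTerm
  | 0 => .zero
  | k + 1 => .union (PTerm.iter (k + 1)) (PTerm.orbit k)

theorem PTerm.eval_iter (τ : Aut A) (x : ℕ → A) (k : ℕ) :
    (PTerm.iter k).eval τ x = τ^[k] (x 0) := by
  induction k with
  | zero => rfl
  | succ k ih => rw [Function.iterate_succ_apply', ← ih]; rfl

theorem PTerm.eval_orbit (τ : Aut A) (x : ℕ → A) (k : ℕ) :
    (PTerm.orbit k).eval τ x = (Finset.range k).sup fun i => τ^[i + 1] (x 0) := by
  induction k with
  | zero => rfl
  | succ k ih => rw [Finset.range_add_one, Finset.sup_insert, ← ih, ← PTerm.eval_iter]; rfl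

/-- Disjointness is built into `wander`, so the supremum over all towers becomes an unrestricted
quantifier over events, which continuous logic can express. -/
theorem PFormula.eval_sup_wander (τ : Aut A) (x : ℕ → A) (k : ℕ) :
    (PFormula.sup 0 (.dist .zero (.inter (.var 0) (.compl (.orbit k))))).eval τ x =
      ⨆ a : A, mu (wander τ k a) := by
  refine iSup_congr fun a => ?_
  change mu (_ ⊓ ((PTerm.orbit k).eval τ (Function.update x 0 a))ᶜ) = _
  rw [PTerm.eval_orbit, wander]
  simp [PTerm.eval]

theorem mu_le_one (a : A) : mu a ≤ 1 := mu_top (A := A) ▸ mu_mono le_top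

theorem IsElementaryEmbedding.iSup_mu_wander {τA : Aut A} {τB : Aut B} {ι : A → B}
    (h : IsElementaryEmbedding τA τB ι) (k : ℕ) :
    ⨆ b : B, mu (wander τB k b) = ⨆ a : A, mu (wander τA k a) := by
  -- The formula is a sentence: its only variable is bound, so the assignment `⊥` is a dummy.
  have := h (.sup 0 (.dist .zero (.inter (.var 0) (.compl (.orbit k))))) fun _ => ⊥
  rwa [PFormula.eval_sup_wander, PFormula.eval_sup_wander] at this

/-- An equation between terms says that the atomic formula measuring their distance has value `0`,
and this value is preserved. The algebraic properties of `ι` follow by choosing terms. -/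
theorem IsElementaryEmbedding.eval_eq {τA : Aut A} {τB : Aut B} {ι : A → B}
    (h : IsElementaryEmbedding τA τB ι) (s t : PTerm) (x : ℕ → A)
    (hst : s.eval τA x = t.eval τA x) :
    s.eval τB (fun i => ι (x i)) = t.eval τB fun i => ι (x i) := by
  have := h (.dist s t) x
  rw [PFormula.eval, PFormula.eval, hst, dist_self] at this
  exact eq_of_dist_eq_zero this

theorem IsElementaryEmbedding.map_tau {τA : Aut A} {τB : Aut B} {ι : A → B}
    (h : IsElementaryEmbedding τA τB ι) (x : A) : τB (ι x) = ι (τA x) :=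
  h.eval_eq (.tau (.var 0)) (.var 1) (fun i => if i = 0 then x else τA x) rfl

theorem IsElementaryEmbedding.map_bot {τA : Aut A} {τB : Aut B} {ι : A → B}
    (h : IsElementaryEmbedding τA τB ι) : ι ⊥ = ⊥ :=
  h.eval_eq (.var 0) .zero (fun _ => ⊥) rfl

theorem IsElementaryEmbedding.map_inf {τA : Aut A} {τB : Aut B} {ι : A → B}
    (h : IsElementaryEmbedding τA τB ι) (x y : A) : ι (x ⊓ y) = ι x ⊓ ι y :=
  h.eval_eq (.var 2) (.inter (.var 0) (.var 1))
    (fun i => if i = 0 then x else if i = 1 then y else x ⊓ y) rfl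

theorem IsElementaryEmbedding.mu_map {τA : Aut A} {τB : Aut B} {ι : A → B}
    (h : IsElementaryEmbedding τA τB ι) (x : A) : mu (ι x) = mu x :=
  h (.dist .zero (.var 0)) fun _ => x

theorem IsElementaryEmbedding.map_iterate {τA : Aut A} {τB : Aut B} {ι : A → B}
    (h : IsElementaryEmbedding τA τB ι) (k : ℕ) (x : A) : τB^[k] (ι x) = ι (τA^[k] x) := by
  induction k with
  | zero => rfl
  | succ k ih => rw [Function.iterate_succ_apply', Function.iterate_succ_apply', ih, h.map_tau]

/-- A partition in an elementary extension yields approximate Rokhlin towers in the small model. -/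
theorem IsElementaryEmbedding.exists_tower {τA : Aut A} {τB : Aut B} {ι : A → B}
    (h : IsElementaryEmbedding τA τB ι) {N : ℕ} (hN : 0 < N) {c : B}
    (hc : GeneratesNPartition c τB N) {r : ℝ} (hr : r < 1 / N) :
    ∃ a : A, r < mu a ∧ ∀ i < N, ∀ j < N, i ≠ j → Disjoint (τA^[i] a) (τA^[j] a) := by
  obtain ⟨k, rfl⟩ : ∃ k, N = k + 1 := ⟨N - 1, by omega⟩
  have hμc : (1 : ℝ) / (k + 1 : ℕ) ≤ mu c := by
    have h₁ := hc.2
    rw [mu_sup_iterate τB hc.1 _ le_rfl] at h₁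
    rw [div_le_iff₀ (by positivity)]
    linarith
  have hbdd : BddAbove (Set.range fun b : B => mu (wander τB k b)) :=
    ⟨1, by rintro _ ⟨b, rfl⟩; exact mu_le_one _⟩
  have hsup := le_ciSup hbdd c
  -- In `B` the bound `1 / N` is witnessed by `c`, which is already the base of a tower. In `A` the
  -- supremum need not be attained, hence the strict `r < 1 / N`.
  rw [wander_eq_self τB hc.1, h.iSup_mu_wander] at hsup
  obtain ⟨a, ha⟩ := exists_lt_of_lt_ciSup ((hr.trans_le hμc).trans_le hsup)
  exact ⟨wander τA k a, ha, fun i hi j hj hij => disjoint_wander τA k a i j hi hj hij⟩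

end Elementary

end PrAlg

end

/-! ### The approximating automorphism -/

theorem lemma2p11 {A : Type*} {B : Type*} [PrAlg.ProbabilityAlgebra A]
    [PrAlg.ProbabilityAlgebra B] (τA : PrAlg.Aut A) (τB : PrAlg.Aut B) (ι : A → B)
    (hA : PrAlg.IsModelAPrA A τA) (hB : PrAlg.IsModelAPrA B τB)
    (hι : PrAlg.IsElementaryEmbedding τA τB ι) (hpart : PrAlg.IsPartitionedOver ι τB)
    (n : ℕ) (hn : 0 < n) (ℓ : PrAlg.Leb) (ρ : PrAlg.Aut PrAlg.Leb)
    (hℓρ : PrAlg.GeneratesNPartition ℓ ρ n) (hρ : ∀ x : PrAlg.Leb, ρ^[n] x = x) :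
    ∃ τ' : PrAlg.Aut B,
      PrAlg.autDist τB τ' ≤ 1 / (2 * (n : ℝ)) ∧
      ∃ f : PrAlg.Iso B (PrAlg.Tensor A PrAlg.Leb),
        (∀ a : A, f (ι a) = PrAlg.inl a) ∧
        ∀ b : B, f (τ' b) = PrAlg.Tensor.map τA ρ (f b) := by
  obtain ⟨-, e, he, hc⟩ := hpart
  obtain ⟨c, hc, -⟩ := hc (4 * n) (by omega)
  have hn' : (0 : ℝ) < n := by exact_mod_cast hn
  obtain ⟨a, ha, hdisj⟩ := hι.exists_tower (by omega) hc
    -- This `r` is `(1/(4n)) (1 - 1/(4n))`: the whole tower covers more than `1 - 1/(4n)`.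
    (r := 1 / (4 * n : ℕ) - 1 / (16 * n ^ 2)) (sub_lt_self _ (by positivity))
  have hdisjB : ∀ i < 4 * n, ∀ j < 4 * n, i ≠ j → Disjoint (τB^[i] (ι a)) (τB^[j] (ι a)) := by
    intro i hi j hj hij
    rw [hι.map_iterate, hι.map_iterate, disjoint_iff, ← hι.map_inf,
      (hdisj i hi j hj hij).eq_bot, hι.map_bot]
  obtain ⟨f, hf, hfj⟩ := PrAlg.exists_intertwining τA τB (PrAlg.Tensor.map τA ρ) ι PrAlg.inl
    hι.map_tau (PrAlg.Tensor.map_inl τA ρ) e he a (4 * n) hdisjB (4 * n - 1) (by omega)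
  -- Conjugating by `f` makes (ii) automatic; only the distance remains.
  refine ⟨f.trans ((PrAlg.Tensor.map τA ρ).trans f.symm), ?_, f, hf, fun b =>
    f.apply_symm_apply' _⟩
  refine (PrAlg.autDist_le_of_eqOn _ _ _ (PrAlg.eqOn_sup _ _
    (s := Finset.range (4 * n - 1)) (p := fun j => τB^[j] (ι a)) fun j hj b hb => ?_)).trans ?_
  · rw [PrAlg.Iso.trans_apply, PrAlg.Iso.trans_apply, ← hfj j (Finset.mem_range.1 hj) b hb,
      PrAlg.Iso.symm_apply_apply']
  · rw [PrAlg.mu_sup_iterate τB hdisjB _ (by omega), hι.mu_map, Nat.cast_sub (by omega)]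
    push_cast at ha ⊢
    have h4 : (0 : ℝ) ≤ 4 * n - 1 := by
      have : (1 : ℝ) ≤ n := by exact_mod_cast hn
      linarith
    have hmul := mul_le_mul_of_nonneg_left ha.le h4
    -- Without the top level `4n - 1` levels remain, and `(4n - 1) r = (1 - 1/(4n))²`, which exceeds
    -- `1 - 1/(2n)`.
    have hval : (4 * (n : ℝ) - 1) * (1 / (4 * n) - 1 / (16 * n ^ 2)) =
        1 - 1 / (2 * n) + 1 / (16 * n ^ 2) := by
      field_simp
      ring
    have hpos : (0 : ℝ) < 1 / (16 * n ^ 2) := by positivity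
    linarith
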